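/- Let $k,r<n$ be positive integers. Let $\Lambda_k$ be the ring of symmetric polynomials in $x_1,\dots,x_k$ over $\mathbb Q$, with complete homogeneous symmetric polynomials $h_m$ ($h_m=0$ for $m<0$), power sums $p_r=x_1^r+\dots+x_k^r$, and Schur polynomials $s_\lambda=\det(h_{\lambda_i+j-i})_{i,j=1}^k$ for partitions $\lambda$ with at most $k$ parts. The quantum cohomology ring of the Grassmannian of $k$-planes in $n$-space is taken in its standard presentation $$qH^*(\mathrm{Gr}(k,n))=\Lambda_k[q]/\langle h_{n-k+1},\dots,h_{n-1},\,h_n+(-1)^kq\rangle ,$$ with product $*$, in which the Schubert cycle $\sigma_\lambda$ of a partition $\lambda\le\Box_{k,n}$ (that is, $\lambda_1\le n-k$ and $\lambda_{k+1}=0$) is the class of $s_\lambda$. We write $p_r$ also for the class of $p_r$. For partitions $\lambda\le\mu$ (containment of Young diagrams), the skew shape $\mu/\lambda$ is the set of boxes of $\mu$ not in $\lambda$, and its size is its number of boxes. It is a rim hook if no two of its boxes lie in the same northwest-to-southeast diagonal and the diagonals that it meets are consecutive. Its height $\mathrm{ht}(\mu/\lambda)$ is the number of rows that it meets. Theorem.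 For every partition $\lambda\le\Box_{k,n}$, $$p_r*\sigma_\lambda=\sum_\mu(-1)^{\mathrm{ht}(\mu/\lambda)+1}\sigma_\mu\;-\;(-1)^k\,q\sum_\nu(-1)^{\mathrm{ht}(\lambda/\nu)+1}\sigma_\nu ,$$ where the first sum is over all $\mu\le\Box_{k,n}$ such that $\mu/\lambda$ is a rim hook of size $r$, and the second sum is over all $\nu\le\lambda$ such that $\lambda/\nu$ is a rim hook of size $n-r$. -/

import Mathlib

namespace QuantumGr

open MvPolynomial

/-! Partitions are Mathlib's `YoungDiagram`s: cells are pairs (row, column), numbered from 0. -/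

/-- The rectangle with `k` rows and `m` columns. -/
def rect (k m : ℕ) : YoungDiagram where
  cells := Finset.range k ×ˢ Finset.range m
  isLowerSet := by
    rintro ⟨a, b⟩ ⟨c, d⟩ hle h
    obtain ⟨h1, h2⟩ := Prod.mk_le_mk.mp hle
    simp only [Finset.coe_product, Finset.coe_range, Set.mem_prod, Set.mem_Iio] at h ⊢
    omega

theorem finite_Iic (β : YoungDiagram) : (Set.Iic β).Finite := by
  refine Set.Finite.of_injOn (f := YoungDiagram.cells) (t := (β.cells.powerset : Set _)) ?_ ?_
    (Finset.finite_toSet _)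
  · intro μ hμ
    simpa using YoungDiagram.cells_subset_iff.mpr hμ
  · intro μ _ ν _ h
    exact YoungDiagram.ext h

/-- The finite set of all partitions `μ ≤ β`. -/
noncomputable def below (β : YoungDiagram) : Finset YoungDiagram := (finite_Iic β).toFinset

theorem mem_below {β μ : YoungDiagram} : μ ∈ below β ↔ μ ≤ β := by
  simp [below]

/-- The boxes of the skew shape `μ / lam`. -/
def skew (μ lam : YoungDiagram) : Finset (ℕ × ℕ) := μ.cells \ lam.cells

/-- The number of boxes of `μ / lam`. -/
def skewSize (μ lam : YoungDiagram) : ℕ := (skew μ lam).card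

/-- The height of `μ / lam`: the number of rows which it meets. -/
def height (μ lam : YoungDiagram) : ℕ := ((skew μ lam).image Prod.fst).card

/-- The index of the Northwest to Southeast diagonal through a box. -/
def diagonal (c : ℕ × ℕ) : ℤ := (c.2 : ℤ) - (c.1 : ℤ)

/-- `μ / lam` is a rim hook: `lam ≤ μ`, no two boxes of `μ / lam` lie in the same diagonal, and
the diagonals that it meets are consecutive. -/
def IsRimHook (μ lam : YoungDiagram) : Prop :=
  lam ≤ μ ∧ Set.InjOn diagonal (skew μ lam : Set (ℕ × ℕ)) ∧
    (diagonal '' (skew μ lam : Set (ℕ × ℕ))).OrdConnected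

/-- The algebra of symmetric polynomials in `x_1, …, x_k` over `ℚ`. -/
abbrev SymPoly (k : ℕ) : Type := symmetricSubalgebra (Fin k) ℚ

noncomputable instance (k : ℕ) : CommRing (SymPoly k) := Subalgebra.toCommRing _

/-- The complete homogeneous symmetric polynomial of degree `m`, zero for negative `m`. -/
noncomputable def complete (k : ℕ) (m : ℤ) : SymPoly k :=
  if 0 ≤ m then ⟨hsymm (Fin k) ℚ m.toNat, hsymm_isSymmetric (Fin k) ℚ m.toNat⟩ else 0

/-- The power sum `x_1 ^ r + … + x_k ^ r`. -/
noncomputable def powerSum (k r : ℕ) : SymPoly k :=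
  ⟨psum (Fin k) ℚ r, psum_isSymmetric (Fin k) ℚ r⟩

/-- The Schur polynomial in `k` variables of a partition with at most `k` rows, by the
Jacobi-Trudi formula. -/
noncomputable def schur (k : ℕ) (lam : YoungDiagram) : SymPoly k :=
  (Matrix.of fun i j : Fin k =>
    complete k ((lam.rowLen (i : ℕ) : ℤ) + ((j : ℕ) : ℤ) - ((i : ℕ) : ℤ))).det

/-- The ideal of `Λ_k[q]` generated by `h_{n-k+1}, …, h_{n-1}` and `h_n + (-1)^k q`. -/
noncomputable def relations (k n : ℕ) : Ideal (Polynomial (SymPoly k)) :=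
  Ideal.span
    ({f | ∃ m : ℕ, n + 1 ≤ m + k ∧ m < n ∧ f = Polynomial.C (complete k (m : ℤ))} ∪
      {Polynomial.C (complete k (n : ℤ)) + (-1) ^ k * Polynomial.X})

/-- The quantum cohomology ring of the Grassmannian `Gr(k,n)`, with its quantum product as the
multiplication: `Λ_k[q] / ⟨h_{n-k+1}, …, h_{n-1}, h_n + (-1)^k q⟩`. -/
abbrev QH (k n : ℕ) : Type := Polynomial (SymPoly k) ⧸ relations k n

/-- The class in `QH k n` of a symmetric polynomial in the Chern roots `x_1, …, x_k` of the dual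
of the tautological bundle. -/
noncomputable def cls (k n : ℕ) (f : SymPoly k) : QH k n :=
  Ideal.Quotient.mk (relations k n) (Polynomial.C f)

/-- The quantum parameter. -/
noncomputable def q (k n : ℕ) : QH k n :=
  Ideal.Quotient.mk (relations k n) Polynomial.X

/-- The Schubert cycle of a partition contained in the `k × (n - k)` rectangle. -/
noncomputable def sigma (k n : ℕ) (lam : YoungDiagram) : QH k n := cls k n (schur k lam)

end QuantumGr

/-!
The proof reduces the quantum product with `p_r` to moving single entries of a strictly decreasing
sequence. Put `u m = h_{m - k + 1}`, so that `u` starts with `k - 1` zeros, followed by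
`h_0, h_1, …`, and attach to a sequence `γ` of `k` natural numbers the determinant
`alternant u γ = det (u (γ_i + j))`. The Jacobi-Trudi determinant of `lam` is the alternant of
`beads k lam`, the sequence `lam_i + k - 1 - i`.

* Since `(∑ (-1)^i e_i t^i) (∑ h_j t^j) = 1`, the sequence `u` satisfies a linear recurrence of
  order `k` with characteristic roots `x_1, …, x_k`. Hence replacing `γ_i` by `γ_i + r` multiplies
  the `i`-th row of the determinant by the `r`-th power of the companion matrix. Its trace is
  `p_r`, because the Vandermonde matrix diagonalizes it, and the sum over `i` of the determinants
  with one row so replaced is the trace times the determinant. So `p_r` times an alternant is the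
  sum of the alternants in which one exponent is increased by `r` (`trace_mul_alternant`).
* In the quantum cohomology ring, `u (n), …, u (n + k - 1)` are `-(-1)^k q` times
  `u (0), …, u (k - 1)`: this is what the defining relations say. By the recurrence,
  `u (m + n) = -(-1)^k q * u m` for all `m` (`clsHom_shiftedComplete_add`), so that an exponent
  which exceeds `n - 1` can be lowered by `n` at the cost of this factor.
* An alternant with a repeated exponent vanishes. Otherwise, increasing one entry of
  `beads k lam` by `r` and sorting yields `beads k μ` for the diagram `μ` with a rim hook
  `μ / lam` of size `r`, and the sorting permutation is a cycle of length `height μ lam`. Decreasing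
  an entry by `n - r` corresponds in the same way to removing a rim hook. This is read off from
  the description `HookRows` of rim hooks by row lengths (`isRimHook_and_skewSize_eq_iff`).
-/

namespace QuantumGr

open MvPolynomial

/-! ### Complete homogeneous and elementary symmetric polynomials -/

section SymmetricFunctions

variable (σ R : Type*) [Fintype σ] [CommRing R]

theorem hsymm_eq_sum_finsuppAntidiag [DecidableEq σ] (n : ℕ) :
    hsymm σ R n = ∑ l ∈ Finset.finsuppAntidiag (Finset.univ : Finset σ) n,
      ∏ i, (X i : MvPolynomial σ R) ^ l i := by
  refine Finset.sum_bij (fun s _ => Multiset.toFinsupp s.1) ?_ ?_ ?_ ?_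
  · intro s _
    simp only [Finset.mem_finsuppAntidiag, Multiset.toFinsupp_apply, Finset.subset_univ, and_true]
    exact (Multiset.sum_count_eq_card fun i _ => Finset.mem_univ i).trans s.2
  · intro s _ t _ h
    exact Subtype.ext (Multiset.toFinsupp.injective h)
  · intro l hl
    simp only [Finset.mem_finsuppAntidiag, Finset.subset_univ, and_true] at hl
    refine ⟨⟨Finsupp.toMultiset l, ?_⟩, Finset.mem_univ _, by simp⟩
    rw [Finsupp.card_toMultiset, Finsupp.sum_fintype _ _ (by simp)]
    exact hl
  · intro s _
    rw [Finset.prod_multiset_map_count]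
    refine Finset.prod_subset (Finset.subset_univ _) ?_
    intro i _ hi
    rw [Multiset.mem_toFinset] at hi
    rw [Multiset.count_eq_zero_of_notMem hi, pow_zero]

theorem coeff_prod_geometric [DecidableEq σ] (n : ℕ) :
    PowerSeries.coeff n (∏ i : σ, PowerSeries.mk fun m => (X i : MvPolynomial σ R) ^ m) =
      hsymm σ R n := by
  rw [PowerSeries.coeff_prod, hsymm_eq_sum_finsuppAntidiag]
  simp

theorem coeff_prod_one_sub (n : ℕ) :
    PowerSeries.coeff n
        (∏ i : σ, (1 - PowerSeries.C (X i : MvPolynomial σ R) * PowerSeries.X)) =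
      (-1) ^ n * esymm σ R n := by
  classical
  simp only [sub_eq_add_neg]
  rw [Finset.prod_one_add, map_sum, esymm, Finset.powersetCard_eq_filter, Finset.sum_filter,
    Finset.mul_sum]
  refine Finset.sum_congr rfl fun t _ => ?_
  have h : ∏ i ∈ t, -(PowerSeries.C (X i : MvPolynomial σ R) * PowerSeries.X) =
      PowerSeries.C ((-1) ^ t.card * ∏ i ∈ t, X i) * PowerSeries.X ^ t.card := by
    rw [Finset.prod_neg, Finset.prod_mul_distrib, Finset.prod_const]
    simp [map_prod, mul_assoc]
  rw [h, PowerSeries.coeff_C_mul, PowerSeries.coeff_X_pow]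
  by_cases hn : n = t.card
  · simp [hn]
  · simp [hn, Ne.symm hn]

/-- The product of the generating series `∑ (-1)^i e_i t^i` and `∑ h_j t^j` is `1`. -/
theorem sum_antidiagonal_esymm_mul_hsymm [DecidableEq σ] {n : ℕ} (hn : n ≠ 0) :
    ∑ p ∈ Finset.HasAntidiagonal.antidiagonal n, (-1) ^ p.1 * esymm σ R p.1 * hsymm σ R p.2 = 0 := by
  have h : (∏ i : σ, (1 - PowerSeries.C (X i : MvPolynomial σ R) * PowerSeries.X)) *
      ∏ i : σ, PowerSeries.mk (fun m => (X i : MvPolynomial σ R) ^ m) = 1 := by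
    rw [← Finset.prod_mul_distrib]
    refine Finset.prod_eq_one fun i _ => ?_
    ext m
    rcases m with _ | m
    · simp
    · rw [sub_mul, one_mul, map_sub, mul_assoc, PowerSeries.coeff_C_mul,
        PowerSeries.coeff_succ_X_mul]
      simp [pow_succ', PowerSeries.coeff_one]
  have h2 := congrArg (PowerSeries.coeff n) h
  rw [PowerSeries.coeff_mul, PowerSeries.coeff_one, if_neg hn] at h2
  rw [← h2]
  exact Finset.sum_congr rfl fun p _ => by rw [coeff_prod_one_sub, coeff_prod_geometric]

theorem sum_neg_one_pow_esymm_mul_X_pow (i : σ) :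
    ∑ j ∈ Finset.range (Fintype.card σ + 1),
      (-1) ^ j * esymm σ R j * (X i : MvPolynomial σ R) ^ (Fintype.card σ - j) = 0 := by
  have h := Multiset.prod_X_sub_X_eq_sum_esymm
    ((Finset.univ : Finset σ).val.map fun i => (X i : MvPolynomial σ R))
  have h2 := congrArg (Polynomial.eval (X i)) h
  simp only [Multiset.card_map, Finset.card_val, Finset.card_univ,
    ← esymm_eq_multiset_esymm] at h2
  rw [Multiset.map_map, Polynomial.eval_multiset_prod, Multiset.map_map,
    Multiset.prod_eq_zero, Polynomial.eval_finsetSum] at h2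
  · rw [h2]
    exact Finset.sum_congr rfl fun j _ => by simp [mul_assoc]
  · exact Multiset.mem_map.mpr ⟨i, by simp, by simp⟩

theorem esymm_eq_zero_of_card_lt {j : ℕ} (hj : Fintype.card σ < j) : esymm σ R j = 0 := by
  rw [esymm, Finset.powersetCard_eq_empty.mpr (by simpa using hj), Finset.sum_empty]

end SymmetricFunctions

/-! ### Replacing rows of a determinant -/

/-- Multiplying the rows of `A` by `M`, one row at a time, multiplies the determinant by the
trace of `M` in total. -/
theorem sum_det_updateRow_vecMul {ι R : Type*} [Fintype ι] [DecidableEq ι] [CommRing R]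
    (A M : Matrix ι ι R) :
    ∑ i, (A.updateRow i (Matrix.vecMul (A i) M)).det = M.trace * A.det := by
  have h : ∀ i, (A.updateRow i (Matrix.vecMul (A i) M)).det = (A * M * A.adjugate) i i := by
    intro i
    rw [← Matrix.cramer_transpose_apply, Matrix.cramer_eq_adjugate_mulVec,
      ← Matrix.adjugate_transpose, Matrix.mulVec_transpose, Matrix.mul_apply]
    rfl
  calc _ = (A * M * A.adjugate).trace := Finset.sum_congr rfl fun i _ => h i
    _ = _ := by
      rw [Matrix.trace_mul_comm, ← Matrix.mul_assoc, Matrix.adjugate_mul, Matrix.smul_mul,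
        Matrix.one_mul, Matrix.trace_smul, smul_eq_mul, mul_comm]

/-! ### The linear recurrence for complete homogeneous polynomials -/

/-- The elementary symmetric polynomial of degree `m` in `x_1, …, x_k`. -/
noncomputable def elementary (k m : ℕ) : SymPoly k :=
  ⟨esymm (Fin k) ℚ m, esymm_isSymmetric (Fin k) ℚ m⟩

/-- The sequence `0, …, 0, h_0, h_1, h_2, …` which starts with `k - 1` zeros, so that all indices
in the Jacobi-Trudi determinants with `k` rows are natural numbers. -/
noncomputable def shiftedComplete (k m : ℕ) : SymPoly k := complete k ((m : ℤ) - k + 1)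

/-- The coefficients `c_j` in `x_i ^ k = ∑ j, c_j x_i ^ j`. -/
noncomputable def recurrenceCoeff (k : ℕ) (j : Fin k) : SymPoly k :=
  -((-1) ^ (k - (j : ℕ)) * elementary k (k - j))

theorem complete_natCast_sub_natCast (k : ℕ) {m i : ℕ} :
    ((complete k ((m : ℤ) - i) : SymPoly k) : MvPolynomial (Fin k) ℚ) =
      if i ≤ m then hsymm (Fin k) ℚ (m - i) else 0 := by
  unfold complete
  by_cases h : i ≤ m
  · rw [if_pos (by omega), if_pos h]
    have : ((m : ℤ) - i).toNat = m - i := by omega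
    simp [this]
  · rw [if_neg (by omega), if_neg h]
    rfl

/-- The recurrence in the form `∑ (-1)^i e_i h_{m-i} = 0`, where `h_{m-i} = 0` if `m < i`. -/
theorem sum_range_elementary_mul_complete (k : ℕ) {m : ℕ} (hm : m ≠ 0) :
    ∑ i ∈ Finset.range (k + 1), (-1) ^ i * elementary k i * complete k ((m : ℤ) - i) = 0 := by
  have key : ∀ a b : ℕ, a ≤ b → (∀ i, a < i → i ≤ b →
      (-1) ^ i * esymm (Fin k) ℚ i * (if i ≤ m then hsymm (Fin k) ℚ (m - i) else 0) = 0) →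
      ∑ i ∈ Finset.range (a + 1),
        (-1) ^ i * esymm (Fin k) ℚ i * (if i ≤ m then hsymm (Fin k) ℚ (m - i) else 0) =
      ∑ i ∈ Finset.range (b + 1),
        (-1) ^ i * esymm (Fin k) ℚ i * (if i ≤ m then hsymm (Fin k) ℚ (m - i) else 0) := by
    intro a b hab h
    refine Finset.sum_subset (Finset.range_mono (by omega)) fun i hi hi' => ?_
    simp only [Finset.mem_range] at hi hi'
    exact h i (by omega) (by omega)
  apply Subtype.ext
  have h1 := sum_antidiagonal_esymm_mul_hsymm (Fin k) ℚ hm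
  rw [Finset.Nat.sum_antidiagonal_eq_sum_range_succ_mk] at h1
  have h2 : ∑ i ∈ Finset.range (m + 1),
        (-1) ^ i * esymm (Fin k) ℚ i * (if i ≤ m then hsymm (Fin k) ℚ (m - i) else 0) = 0 := by
    rw [← h1]
    refine Finset.sum_congr rfl fun i hi => ?_
    rw [if_pos (by simpa [Nat.lt_succ_iff] using hi)]
  rw [AddSubmonoidClass.coe_finsetSum]
  simp only [MulMemClass.coe_mul, SubmonoidClass.coe_pow, NegMemClass.coe_neg, OneMemClass.coe_one,
    complete_natCast_sub_natCast, elementary, ZeroMemClass.coe_zero]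
  rcases le_total k m with h | h
  · rw [key k m h, h2]
    intro i hi _
    rw [esymm_eq_zero_of_card_lt _ _ (by simpa using hi)]
    ring
  · rw [← key m k h, h2]
    intro i hi _
    rw [if_neg (by omega), mul_zero]

theorem shiftedComplete_add_self (k m : ℕ) :
    shiftedComplete k (m + k) =
      ∑ j : Fin k, shiftedComplete k (m + j) * recurrenceCoeff k j := by
  have h := sum_range_elementary_mul_complete k (Nat.succ_ne_zero m)
  rw [Finset.sum_range_succ', ← Finset.sum_range_reflect] at h
  have h0 : shiftedComplete k (m + k) =
      (-1) ^ 0 * elementary k 0 * complete k ((m.succ : ℤ) - (0 : ℕ)) := by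
    have h1 : elementary k 0 = 1 := Subtype.ext (esymm_zero (Fin k) ℚ)
    rw [h1, pow_zero, one_mul, one_mul, shiftedComplete]
    congr 1
    push_cast
    ring
  rw [h0, ← sub_eq_zero, ← h, sub_eq_add_neg, add_comm]
  congr 1
  rw [← Finset.sum_neg_distrib, ← Fin.sum_univ_eq_sum_range
    (fun j => (-1) ^ (k - 1 - j + 1) * elementary k (k - 1 - j + 1) *
      complete k ((m.succ : ℤ) - (k - 1 - j + 1 : ℕ)))]
  refine Finset.sum_congr rfl fun j _ => ?_
  have hj : k - 1 - (j : ℕ) + 1 = k - j := by omega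
  have hj2 : ((m.succ : ℤ) - (k - j : ℕ)) = ((m + j : ℕ) : ℤ) - k + 1 := by
    have := j.2
    push_cast [this.le]
    ring
  rw [hj, hj2, recurrenceCoeff, shiftedComplete]
  ring

/-- The variables are the characteristic roots of the recurrence. -/
theorem X_pow_card_eq (k : ℕ) (i : Fin k) :
    (X i : MvPolynomial (Fin k) ℚ) ^ k =
      ∑ j : Fin k, X i ^ (j : ℕ) * (recurrenceCoeff k j : MvPolynomial (Fin k) ℚ) := by
  have h := sum_neg_one_pow_esymm_mul_X_pow (Fin k) ℚ i
  rw [Fintype.card_fin, Finset.sum_range_succ', ← Finset.sum_range_reflect] at h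
  simp only [pow_zero, esymm_zero, one_mul, Nat.sub_zero] at h
  rw [← sub_eq_zero, ← h, sub_eq_add_neg, add_comm]
  congr 1
  rw [← Finset.sum_neg_distrib, ← Fin.sum_univ_eq_sum_range
    (fun j => (-1) ^ (k - 1 - j + 1) * esymm (Fin k) ℚ (k - 1 - j + 1) *
      X i ^ (k - (k - 1 - j + 1)))]
  refine Finset.sum_congr rfl fun j _ => ?_
  have hj : k - 1 - (j : ℕ) + 1 = k - j := by omega
  have hj2 : k - (k - (j : ℕ)) = j := by omega
  rw [hj, hj2]
  simp only [recurrenceCoeff, elementary, MulMemClass.coe_mul, SubmonoidClass.coe_pow,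
    NegMemClass.coe_neg, OneMemClass.coe_one]
  ring

/-! ### The companion matrix -/

/-- The companion matrix, acting on row vectors from the right, of the recurrence
`u (m + k) = ∑ j, u (m + j) * c j`. -/
def companion {R : Type*} [CommRing R] {k : ℕ} (c : Fin k → R) : Matrix (Fin k) (Fin k) R :=
  Matrix.of fun i j => if (j : ℕ) + 1 = k then c i else if (i : ℕ) = j + 1 then 1 else 0

section Companion

variable {R : Type*} [CommRing R] {k : ℕ} {c : Fin k → R} {u : ℕ → R}

theorem vecMul_companion (hu : ∀ m, u (m + k) = ∑ j : Fin k, u (m + j) * c j) (m : ℕ) :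
    Matrix.vecMul (fun j : Fin k => u (m + j)) (companion c) =
      fun j : Fin k => u (m + 1 + j) := by
  funext j
  simp only [Matrix.vecMul, dotProduct, companion, Matrix.of_apply]
  by_cases hj : (j : ℕ) + 1 = k
  · simp only [hj, if_true]
    rw [← hu]
    congr 1
    omega
  · have hj' : (j : ℕ) + 1 < k := by omega
    simp only [hj, if_false]
    rw [Finset.sum_eq_single ⟨j + 1, hj'⟩]
    · simp only [if_true, mul_one]
      congr 1
      omega
    · intro i _ hi
      rw [if_neg (fun h => hi (Fin.ext h)), mul_zero]
    · simp

theorem vecMul_companion_pow (hu : ∀ m, u (m + k) = ∑ j : Fin k, u (m + j) * c j) (m r : ℕ) :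
    Matrix.vecMul (fun j : Fin k => u (m + j)) (companion c ^ r) =
      fun j : Fin k => u (m + r + j) := by
  induction r with
  | zero => simp
  | succ r ih => rw [pow_succ, ← Matrix.vecMul_vecMul, ih, vecMul_companion hu, add_assoc m r 1]

/-- If the recurrence has `k` distinct characteristic roots, then the trace of the `r`-th power of
its companion matrix is their `r`-th power sum: the Vandermonde matrix diagonalizes it. -/
theorem trace_companion_pow [IsDomain R] {x : Fin k → R} (hx : Function.Injective x)
    (hc : ∀ i, x i ^ k = ∑ j : Fin k, x i ^ (j : ℕ) * c j) (r : ℕ) :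
    (companion c ^ r).trace = ∑ i, x i ^ r := by
  have hV : Matrix.vandermonde x * companion c ^ r =
      Matrix.diagonal (fun i => x i ^ r) * Matrix.vandermonde x := by
    ext i j
    have h := vecMul_companion_pow (c := c) (u := fun m => x i ^ m)
      (fun m => by simp only [pow_add, hc i, Finset.mul_sum, mul_assoc]) 0 r
    have h2 := congrFun h j
    simp only [zero_add] at h2
    rw [Matrix.diagonal_mul, Matrix.vandermonde_apply, ← pow_add, ← h2]
    rfl
  have hdet : (Matrix.vandermonde x).det ≠ 0 := Matrix.det_vandermonde_ne_zero_iff.mpr hx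
  refine mul_left_cancel₀ hdet ?_
  have h1 : (Matrix.vandermonde x * companion c ^ r * (Matrix.vandermonde x).adjugate).trace =
      (Matrix.vandermonde x).det * (companion c ^ r).trace := by
    rw [Matrix.trace_mul_comm, ← Matrix.mul_assoc, Matrix.adjugate_mul, Matrix.smul_mul,
      Matrix.one_mul, Matrix.trace_smul, smul_eq_mul]
  rw [← h1, hV, Matrix.mul_assoc, Matrix.mul_adjugate, Matrix.mul_smul, Matrix.mul_one,
    Matrix.trace_smul, smul_eq_mul, Matrix.trace_diagonal]

theorem trace_map_companion_pow {S : Type*} [CommRing S] (φ : R →+* S) (c : Fin k → R) (r : ℕ) :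
    φ (companion c ^ r).trace = (companion (fun j => φ (c j)) ^ r).trace := by
  have hmap : companion (fun j => φ (c j)) = φ.mapMatrix (companion c) := by
    ext1 i j
    simp only [companion, RingHom.mapMatrix_apply, Matrix.map_apply, Matrix.of_apply]
    split_ifs <;> simp
  rw [hmap, ← map_pow]
  simp [Matrix.trace]

/-! ### Determinants indexed by exponent sequences -/

/-- The determinant with rows `u (γ i), …, u (γ i + k - 1)`. -/
def alternant (u : ℕ → R) (γ : Fin k → ℕ) : R :=
  (Matrix.of fun i j : Fin k => u (γ i + j)).det

theorem map_alternant {S : Type*} [CommRing S] (φ : R →+* S) (u : ℕ → R) (γ : Fin k → ℕ) :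
    φ (alternant u γ) = alternant (fun m => φ (u m)) γ := by
  rw [alternant, RingHom.map_det]
  rfl

theorem trace_mul_alternant (hu : ∀ m, u (m + k) = ∑ j : Fin k, u (m + j) * c j) (r : ℕ)
    (γ : Fin k → ℕ) :
    (companion c ^ r).trace * alternant u γ =
      ∑ i, alternant u (Function.update γ i (γ i + r)) := by
  rw [alternant, ← sum_det_updateRow_vecMul]
  refine Finset.sum_congr rfl fun i _ => ?_
  rw [alternant]
  congr 1
  have h := vecMul_companion_pow hu (γ i) r
  ext a b
  by_cases ha : a = i
  · subst ha
    rw [Matrix.updateRow_self]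
    exact (congrFun h b).trans (by simp)
  · simp [ha]

theorem alternant_comp_perm (u : ℕ → R) (γ : Fin k → ℕ) (τ : Equiv.Perm (Fin k)) :
    alternant u (γ ∘ τ) = (Equiv.Perm.sign τ : ℤ) * alternant u γ := by
  rw [alternant, alternant, ← Matrix.det_permute]
  rfl

theorem alternant_eq_zero (u : ℕ → R) {γ : Fin k → ℕ} {i j : Fin k} (hij : i ≠ j)
    (h : γ i = γ j) : alternant u γ = 0 :=
  Matrix.det_zero_of_row_eq hij (by funext b; simp [h])

/-- A solution of the recurrence is quasi-periodic if its first `k` values are. -/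
theorem quasiperiodic_of_recurrence (hu : ∀ m, u (m + k) = ∑ j : Fin k, u (m + j) * c j)
    {n : ℕ} {ε : R} (h : ∀ m < k, u (m + n) = ε * u m) (m : ℕ) : u (m + n) = ε * u m := by
  induction m using Nat.strong_induction_on with
  | _ m ih =>
    by_cases hm : k ≤ m
    · obtain ⟨m, rfl⟩ := Nat.exists_eq_add_of_le' hm
      rw [show m + k + n = m + n + k by omega, hu, hu, Finset.mul_sum]
      refine Finset.sum_congr rfl fun j _ => ?_
      rw [show m + n + (j : ℕ) = m + j + n by omega, ih (m + j) (by omega), mul_assoc]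
    · exact h m (by omega)

theorem alternant_update_add {n : ℕ} {ε : R} (h : ∀ m, u (m + n) = ε * u m) (γ : Fin k → ℕ)
    (i : Fin k) (m : ℕ) :
    alternant u (Function.update γ i (m + n)) = ε * alternant u (Function.update γ i m) := by
  have h1 : ∀ l, Matrix.of (fun a b : Fin k => u (Function.update γ i l a + b)) =
      Matrix.updateRow (Matrix.of fun a b : Fin k => u (γ a + b)) i fun b => u (l + b) := by
    intro l
    ext a b
    by_cases ha : a = i
    · subst ha
      simp
    · simp [ha]
  have h2 : (fun b : Fin k => u (m + n + b)) = ε • fun b : Fin k => u (m + b) := by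
    funext b
    rw [show m + n + (b : ℕ) = m + b + n by omega, h]
    rfl
  rw [alternant, alternant, h1, h1, h2, Matrix.det_updateRow_smul]

end Companion

/-! ### Power sums as traces, Schur polynomials as alternants -/

theorem trace_companion_recurrenceCoeff_pow (k r : ℕ) :
    (companion (recurrenceCoeff k) ^ r).trace = powerSum k r := by
  apply Subtype.ext
  have h := trace_map_companion_pow (symmetricSubalgebra (Fin k) ℚ).val.toRingHom
    (recurrenceCoeff k) r
  exact h.trans (trace_companion_pow (X_injective (σ := Fin k) (R := ℚ)) (X_pow_card_eq k) r)

/-- The strictly decreasing sequence `lam_i + k - 1 - i`. -/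
def beads (k : ℕ) (lam : YoungDiagram) (i : Fin k) : ℕ := lam.rowLen i + (k - 1 - i)

theorem alternant_beads (k : ℕ) (lam : YoungDiagram) :
    alternant (shiftedComplete k) (beads k lam) = schur k lam := by
  unfold alternant schur shiftedComplete beads
  congr 2
  funext i j
  congr 1
  have := i.2
  push_cast [show (i : ℕ) ≤ k - 1 by omega, show 1 ≤ k by omega]
  ring

/-! ### Passing to the quantum cohomology ring -/

/-- The map `cls` as a ring homomorphism. -/
noncomputable def clsHom (k n : ℕ) : SymPoly k →+* QH k n :=
  (Ideal.Quotient.mk (relations k n)).comp Polynomial.C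

theorem cls_complete_self (k n : ℕ) : cls k n (complete k n) = -(-1) ^ k * q k n := by
  have h : Ideal.Quotient.mk (relations k n)
      (Polynomial.C (complete k (n : ℤ)) + (-1) ^ k * Polynomial.X) = 0 :=
    Ideal.Quotient.eq_zero_iff_mem.mpr (Ideal.subset_span (Or.inr rfl))
  rw [map_add, map_mul, map_pow, map_neg, map_one] at h
  -- stated for an abstract ring: `QH k n` carries several ring structures which agree only after
  -- unfolding, and this stops `ring`
  have key : ∀ {R : Type} [CommRing R] {a b c : R}, a + b * c = 0 → a = -b * c :=
    fun h => by linear_combination h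
  exact key (R := QH k n) h

theorem clsHom_shiftedComplete_recurrence (k n m : ℕ) :
    clsHom k n (shiftedComplete k (m + k)) =
      ∑ j : Fin k, clsHom k n (shiftedComplete k (m + j)) * clsHom k n (recurrenceCoeff k j) := by
  rw [shiftedComplete_add_self, map_sum]
  exact Finset.sum_congr rfl fun j _ => map_mul _ _ _

/-- The defining relations of the quantum cohomology ring make the sequence of complete
homogeneous polynomials quasi-periodic. -/
theorem clsHom_shiftedComplete_add {k n : ℕ} (hkn : k < n) (m : ℕ) :
    clsHom k n (shiftedComplete k (m + n)) =
      -(-1) ^ k * q k n * clsHom k n (shiftedComplete k m) := by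
  refine quasiperiodic_of_recurrence (u := fun m => clsHom k n (shiftedComplete k m))
    (clsHom_shiftedComplete_recurrence k n) (fun m hm => ?_) m
  by_cases hm' : m + 1 = k
  · -- the relation `h_n = -(-1)^k q`, as the last of the first `k` values is `h_0 = 1`
    have h1 : shiftedComplete k m = 1 := by
      rw [shiftedComplete, complete, if_pos (by omega)]
      apply Subtype.ext
      have : ((m : ℤ) - k + 1).toNat = 0 := by omega
      simp [this]
    have h2 : shiftedComplete k (m + n) = complete k (n : ℤ) := by
      rw [shiftedComplete]
      congr 1
      omega
    simp only [h1, h2, map_one]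
    exact (cls_complete_self k n).trans (mul_one (M := QH k n) _).symm
  · have h1 : shiftedComplete k m = 0 := by
      rw [shiftedComplete, complete, if_neg (by omega)]
    have h2 : shiftedComplete k (m + n) = complete k ((m + n + 1 - k : ℕ) : ℤ) := by
      rw [shiftedComplete]
      congr 1
      omega
    have h3 : clsHom k n (complete k ((m + n + 1 - k : ℕ) : ℤ)) = 0 :=
      Ideal.Quotient.eq_zero_iff_mem.mpr
        (Ideal.subset_span (Or.inl ⟨m + n + 1 - k, by omega, by omega, rfl⟩))
    simp only [h1, h2, h3, map_zero]
    exact (mul_zero (M₀ := QH k n) _).symm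

/-! ### Young diagrams and their row lengths -/

theorem le_iff_rowLen_le {μ ν : YoungDiagram} : μ ≤ ν ↔ ∀ i, μ.rowLen i ≤ ν.rowLen i := by
  constructor
  · intro h i
    by_contra! hi
    exact lt_irrefl _ (YoungDiagram.mem_iff_lt_rowLen.mp
      (h (YoungDiagram.mem_iff_lt_rowLen.mpr hi)))
  · rintro h ⟨i, j⟩ hc
    exact YoungDiagram.mem_iff_lt_rowLen.mpr
      ((YoungDiagram.mem_iff_lt_rowLen.mp hc).trans_le (h i))

theorem eq_of_rowLen_eq {μ ν : YoungDiagram} (h : ∀ i, μ.rowLen i = ν.rowLen i) : μ = ν :=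
  le_antisymm (le_iff_rowLen_le.mpr fun i => (h i).le) (le_iff_rowLen_le.mpr fun i => (h i).ge)

theorem exists_rowLen_eq {f : ℕ → ℕ} (hf : Antitone f) {k : ℕ} (hk : f k = 0) :
    ∃ μ : YoungDiagram, ∀ i, μ.rowLen i = f i := by
  let μ : YoungDiagram :=
    { cells := (Finset.range k ×ˢ Finset.range (f 0)).filter fun c => c.2 < f c.1
      isLowerSet := by
        rintro ⟨a, b⟩ ⟨c, d⟩ hle h
        obtain ⟨h1, h2⟩ := Prod.mk_le_mk.mp hle
        simp only [Finset.coe_filter, Finset.mem_product, Finset.mem_range,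
          Set.mem_ofPred_eq] at h ⊢
        have := hf h1
        omega }
  have hmem : ∀ i j, (i, j) ∈ μ ↔ j < f i := by
    intro i j
    change (i, j) ∈ (Finset.range k ×ˢ Finset.range (f 0)).filter (fun c => c.2 < f c.1) ↔ _
    simp only [Finset.mem_filter, Finset.mem_product, Finset.mem_range]
    refine ⟨fun h => h.2, fun h => ⟨⟨?_, h.trans_le (hf (Nat.zero_le i))⟩, h⟩⟩
    by_contra! hik
    have := hf hik
    omega
  refine ⟨μ, fun i => eq_of_forall_lt_iff fun j => ?_⟩
  rw [← YoungDiagram.mem_iff_lt_rowLen, hmem]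

theorem rowLen_rect (k m i : ℕ) : (rect k m).rowLen i = if i < k then m else 0 := by
  refine eq_of_forall_lt_iff fun j => ?_
  rw [← YoungDiagram.mem_iff_lt_rowLen]
  change (i, j) ∈ Finset.range k ×ˢ Finset.range m ↔ _
  split_ifs with h <;> simp [h]

theorem le_rect_iff {k m : ℕ} {μ : YoungDiagram} :
    μ ≤ rect k m ↔ μ.rowLen 0 ≤ m ∧ μ.rowLen k = 0 := by
  rw [le_iff_rowLen_le]
  constructor
  · intro h
    have h0 := h 0
    have hk := h k
    rw [rowLen_rect] at h0 hk
    refine ⟨h0.trans ?_, by simpa using hk⟩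
    split_ifs <;> omega
  · rintro ⟨h0, hk⟩ i
    rw [rowLen_rect]
    split_ifs with h
    · exact (μ.rowLen_anti 0 i (Nat.zero_le i)).trans h0
    · exact (μ.rowLen_anti k i (by omega)).trans hk.le

theorem mem_skew {μ lam : YoungDiagram} {i j : ℕ} :
    (i, j) ∈ skew μ lam ↔ lam.rowLen i ≤ j ∧ j < μ.rowLen i := by
  rw [skew, Finset.mem_sdiff, YoungDiagram.mem_cells, YoungDiagram.mem_cells,
    YoungDiagram.mem_iff_lt_rowLen, YoungDiagram.mem_iff_lt_rowLen]
  omega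

/-! ### Rim hooks by rows -/

/-- The row lengths of `μ` are those of a diagram obtained from `lam` by adding a rim hook of size
`r` in the rows `a, …, b`. In terms of the sequences `lam_i - i` and `μ_i - i`: the entry with
index `b` is increased by `r` and moved to the index `a`. -/
structure HookRows (μ lam : YoungDiagram) (a b r : ℕ) : Prop where
  le : a ≤ b
  eq_off : ∀ i, i < a ∨ b < i → μ.rowLen i = lam.rowLen i
  succ : ∀ i, a ≤ i → i < b → μ.rowLen (i + 1) = lam.rowLen i + 1
  top : μ.rowLen a + b = lam.rowLen b + r + a

namespace HookRows

variable {μ lam : YoungDiagram} {a b r : ℕ}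

theorem rowLen_lt (h : HookRows μ lam a b r) (hr : 0 < r) {i : ℕ} (ha : a ≤ i) (hb : i ≤ b) :
    lam.rowLen i < μ.rowLen i := by
  have htop := h.top
  rcases hb.lt_or_eq with hib | rfl
  · have h1 := h.succ i ha hib
    have h2 := μ.rowLen_anti i (i + 1) (by omega)
    omega
  · rcases ha.lt_or_eq with hai | rfl
    · have h1 := h.succ (i - 1) (by omega) (by omega)
      rw [show i - 1 + 1 = i by omega] at h1
      have h2 := lam.rowLen_anti (i - 1) i (by omega)
      omega
    · omega

theorem rows_unique {a' b' : ℕ} (h : HookRows μ lam a b r) (h' : HookRows μ lam a' b' r)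
    (hr : 0 < r) : a = a' ∧ b = b' := by
  have key : ∀ {a b a' b' : ℕ}, HookRows μ lam a b r → HookRows μ lam a' b' r →
      a' ≤ a ∧ b ≤ b' := by
    intro a b a' b' h h'
    have ha := h.rowLen_lt hr le_rfl h.le
    have hb := h.rowLen_lt hr h.le le_rfl
    constructor <;> by_contra! hlt
    · exact ha.ne' (h'.eq_off a (Or.inl hlt))
    · exact hb.ne' (h'.eq_off b (Or.inr hlt))
  have h1 := key h h'
  have h2 := key h' h
  omega

theorem lam_le (h : HookRows μ lam a b r) (hr : 0 < r) : lam ≤ μ := by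
  refine le_iff_rowLen_le.mpr fun i => ?_
  by_cases hi : i < a ∨ b < i
  · exact (h.eq_off i hi).ge
  · exact (h.rowLen_lt hr (by omega) (by omega)).le

theorem mem_rows (h : HookRows μ lam a b r) {c : ℕ × ℕ} (hc : c ∈ skew μ lam) :
    a ≤ c.1 ∧ c.1 ≤ b := by
  obtain ⟨h1, h2⟩ := mem_skew.mp (show (c.1, c.2) ∈ skew μ lam from hc)
  by_contra hi
  have := h.eq_off c.1 (by omega)
  omega

theorem height_eq (h : HookRows μ lam a b r) (hr : 0 < r) : height μ lam = b - a + 1 := by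
  have himage : (skew μ lam).image Prod.fst = Finset.Icc a b := by
    ext i
    simp only [Finset.mem_image, Finset.mem_Icc]
    constructor
    · rintro ⟨c, hc, rfl⟩
      exact h.mem_rows hc
    · rintro ⟨ha, hb⟩
      exact ⟨(i, lam.rowLen i), mem_skew.mpr ⟨le_rfl, h.rowLen_lt hr ha hb⟩, rfl⟩
  have := h.le
  rw [height, himage, Nat.card_Icc]
  omega

/-- Going down the rows, the diagonals met by the skew shape decrease. -/
theorem diagonal_injOn (h : HookRows μ lam a b r) :
    Set.InjOn diagonal (skew μ lam : Set (ℕ × ℕ)) := by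
  have key : ∀ c ∈ skew μ lam, ∀ d ∈ skew μ lam, c.1 < d.1 → diagonal d < diagonal c := by
    intro c hc d hd hcd
    have hca := (h.mem_rows hc).1
    have hdb := (h.mem_rows hd).2
    obtain ⟨h1, -⟩ := mem_skew.mp (show (c.1, c.2) ∈ skew μ lam from hc)
    obtain ⟨-, h4⟩ := mem_skew.mp (show (d.1, d.2) ∈ skew μ lam from hd)
    have h5 := h.succ c.1 hca (by omega)
    have h6 := μ.rowLen_anti (c.1 + 1) d.1 (by omega)
    unfold diagonal
    omega
  intro c hc d hd hcd
  rcases lt_trichotomy c.1 d.1 with hlt | heq | hlt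
  · exact absurd hcd (key c hc d hd hlt).ne'
  · refine Prod.ext heq ?_
    unfold diagonal at hcd
    omega
  · exact absurd hcd (key d hd c hc hlt).ne

theorem diagonal_image (h : HookRows μ lam a b r) :
    diagonal '' (skew μ lam : Set (ℕ × ℕ)) =
      Set.Ico ((lam.rowLen b : ℤ) - b) ((μ.rowLen a : ℤ) - a) := by
  ext d
  simp only [Set.mem_image, Finset.mem_coe, Set.mem_Ico]
  constructor
  · rintro ⟨c, hc, rfl⟩
    obtain ⟨ha, hb⟩ := h.mem_rows hc
    obtain ⟨h1, h2⟩ := mem_skew.mp (show (c.1, c.2) ∈ skew μ lam from hc)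
    have h3 := lam.rowLen_anti c.1 b hb
    have h4 := μ.rowLen_anti a c.1 ha
    unfold diagonal
    omega
  · rintro ⟨hd1, hd2⟩
    -- the box on the diagonal `d` lies in the first row `i` with `lam_i - i ≤ d`
    classical
    have hex : ∃ i, a ≤ i ∧ (lam.rowLen i : ℤ) - i ≤ d := ⟨b, h.le, hd1⟩
    obtain ⟨hia, hid⟩ := Nat.find_spec hex
    have hib : Nat.find hex ≤ b := Nat.find_min' hex ⟨h.le, hd1⟩
    have hmin := fun m hm => Nat.find_min hex (m := m) hm
    generalize Nat.find hex = i at hia hid hib hmin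
    have hiμ : d < (μ.rowLen i : ℤ) - i := by
      rcases hia.lt_or_eq with hai | rfl
      · have h1 := hmin (i - 1) (by omega)
        have h2 := h.succ (i - 1) (by omega) (by omega)
        rw [show i - 1 + 1 = i by omega] at h2
        push Not at h1
        have h3 := h1 (by omega)
        omega
      · exact hd2
    refine ⟨(i, (d + i).toNat), mem_skew.mpr ⟨by omega, by omega⟩, ?_⟩
    simp only [diagonal]
    omega

theorem skewSize_eq (h : HookRows μ lam a b r) : skewSize μ lam = r := by
  have h1 : (skew μ lam).image diagonal =
      Finset.Ico ((lam.rowLen b : ℤ) - b) ((μ.rowLen a : ℤ) - a) := by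
    rw [← Finset.coe_inj, Finset.coe_image, h.diagonal_image, Finset.coe_Ico]
  have htop := h.top
  rw [skewSize, ← Finset.card_image_of_injOn h.diagonal_injOn, h1, Int.card_Ico]
  omega

theorem isRimHook (h : HookRows μ lam a b r) (hr : 0 < r) : IsRimHook μ lam :=
  ⟨h.lam_le hr, h.diagonal_injOn, h.diagonal_image ▸ Set.ordConnected_Ico⟩

end HookRows

theorem IsRimHook.exists_hookRows {μ lam : YoungDiagram} (h : IsRimHook μ lam)
    (hr : 0 < skewSize μ lam) : ∃ a b, HookRows μ lam a b (skewSize μ lam) := by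
  obtain ⟨hle, hinj, hconn⟩ := h
  rw [le_iff_rowLen_le] at hle
  have hne : ((skew μ lam).image Prod.fst).Nonempty := (Finset.card_pos.mp hr).image _
  obtain ⟨ca, hca, hca'⟩ := Finset.mem_image.mp (Finset.min'_mem _ hne)
  obtain ⟨cb, hcb, hcb'⟩ := Finset.mem_image.mp (Finset.max'_mem _ hne)
  have hmin : ∀ c ∈ skew μ lam, ca.1 ≤ c.1 := fun c hc =>
    hca' ▸ Finset.min'_le _ _ (Finset.mem_image_of_mem _ hc)
  have hmax : ∀ c ∈ skew μ lam, c.1 ≤ cb.1 := fun c hc =>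
    hcb' ▸ Finset.le_max' _ _ (Finset.mem_image_of_mem _ hc)
  have hoff : ∀ i, i < ca.1 ∨ cb.1 < i → μ.rowLen i = lam.rowLen i := by
    intro i hi
    by_contra hne
    have hmem : (i, lam.rowLen i) ∈ skew μ lam :=
      mem_skew.mpr ⟨le_rfl, lt_of_le_of_ne (hle i) (Ne.symm hne)⟩
    have h1 := hmin _ hmem
    have h2 := hmax _ hmem
    simp only at h1 h2
    omega
  have hsucc : ∀ i, ca.1 ≤ i → i < cb.1 → μ.rowLen (i + 1) = lam.rowLen i + 1 := by
    intro i hi1 hi2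
    refine le_antisymm ?_ ?_
    · -- otherwise two boxes in adjacent rows share a diagonal
      by_contra! hlt
      have h1 := μ.rowLen_anti i (i + 1) (by omega)
      have h2 := lam.rowLen_anti i (i + 1) (by omega)
      have h3 := hinj (x₁ := (i, lam.rowLen i)) (x₂ := (i + 1, lam.rowLen i + 1))
        (mem_skew.mpr ⟨le_rfl, by omega⟩) (mem_skew.mpr ⟨by omega, by omega⟩)
        (by simp [diagonal])
      simp at h3
    · -- otherwise the diagonal `lam_i - i - 1` is skipped
      by_contra! hlt
      obtain ⟨h1, -⟩ := mem_skew.mp (show (ca.1, ca.2) ∈ skew μ lam from hca)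
      obtain ⟨-, h2⟩ := mem_skew.mp (show (cb.1, cb.2) ∈ skew μ lam from hcb)
      have h3 := lam.rowLen_anti ca.1 i hi1
      have h4 := μ.rowLen_anti (i + 1) cb.1 hi2
      obtain ⟨c, hc, hcd⟩ := hconn.out (Set.mem_image_of_mem diagonal hcb)
        (Set.mem_image_of_mem diagonal hca)
        (show (lam.rowLen i : ℤ) - i - 1 ∈ Set.Icc (diagonal cb) (diagonal ca) by
          simp only [diagonal, Set.mem_Icc]
          omega)
      obtain ⟨h5, h6⟩ := mem_skew.mp (show (c.1, c.2) ∈ skew μ lam from hc)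
      unfold diagonal at hcd
      rcases le_or_gt c.1 i with hci | hci
      · have := lam.rowLen_anti c.1 i hci
        omega
      · have := μ.rowLen_anti (i + 1) c.1 hci
        omega
  have hab := hmin cb hcb
  obtain ⟨h1, h2⟩ := mem_skew.mp (show (ca.1, ca.2) ∈ skew μ lam from hca)
  have h3 := lam.rowLen_anti ca.1 cb.1 hab
  -- the size is forced, so it can be read off from the shape
  have hshape : HookRows μ lam ca.1 cb.1 (μ.rowLen ca.1 + cb.1 - (lam.rowLen cb.1 + ca.1)) :=
    ⟨hab, hoff, hsucc, by omega⟩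
  exact ⟨ca.1, cb.1, hshape.skewSize_eq ▸ hshape⟩

theorem isRimHook_and_skewSize_eq_iff {μ lam : YoungDiagram} {r : ℕ} (hr : 0 < r) :
    IsRimHook μ lam ∧ skewSize μ lam = r ↔ ∃ a b, HookRows μ lam a b r := by
  constructor
  · rintro ⟨h, rfl⟩
    exact h.exists_hookRows hr
  · rintro ⟨a, b, h⟩
    exact ⟨h.isRimHook hr, h.skewSize_eq⟩

/-! ### Existence and uniqueness of rim hooks -/

/-- The rim hook of size `r` added to `lam` is determined by its last row. -/
theorem HookRows.outer_unique {μ μ' lam : YoungDiagram} {a a' b r : ℕ}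
    (h : HookRows μ lam a b r) (h' : HookRows μ' lam a' b r) : μ = μ' := by
  have key : ∀ {μ μ' : YoungDiagram} {a a' : ℕ}, HookRows μ lam a b r →
      HookRows μ' lam a' b r → ¬ a < a' := by
    intro μ μ' a a' h h' haa
    have h1 := h.succ (a' - 1) (by omega) (by have := h'.le; omega)
    have h2 := h'.eq_off (a' - 1) (by omega)
    have h3 := μ.rowLen_anti a a' haa.le
    have h4 := μ'.rowLen_anti (a' - 1) a' (by omega)
    have h5 := h.top
    have h6 := h'.top
    rw [show a' - 1 + 1 = a' by omega] at h1
    omega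
  obtain rfl : a = a' := le_antisymm (not_lt.mp (key h' h)) (not_lt.mp (key h h'))
  refine eq_of_rowLen_eq fun i => ?_
  by_cases hi : i < a ∨ b < i
  · rw [h.eq_off i hi, h'.eq_off i hi]
  · rcases (show a ≤ i by omega).lt_or_eq with hai | rfl
    · have h1 := h.succ (i - 1) (by omega) (by omega)
      have h2 := h'.succ (i - 1) (by omega) (by omega)
      rw [show i - 1 + 1 = i by omega] at h1 h2
      rw [h1, h2]
    · have h1 := h.top
      have h2 := h'.top
      omega

/-- The rim hook of size `s` removed from `lam` is determined by its first row. -/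
theorem HookRows.inner_unique {lam ν ν' : YoungDiagram} {a b b' s : ℕ}
    (h : HookRows lam ν a b s) (h' : HookRows lam ν' a b' s) : ν = ν' := by
  have key : ∀ {ν ν' : YoungDiagram} {b b' : ℕ}, HookRows lam ν a b s →
      HookRows lam ν' a b' s → ¬ b < b' := by
    intro ν ν' b b' h h' hbb
    have h1 := h'.succ b h.le hbb
    have h2 := h.eq_off (b + 1) (by omega)
    have h3 := ν'.rowLen_anti b b' hbb.le
    have h4 := ν.rowLen_anti b (b + 1) (by omega)
    have h5 := h.top
    have h6 := h'.top
    omega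
  obtain rfl : b = b' := le_antisymm (not_lt.mp (key h' h)) (not_lt.mp (key h h'))
  refine eq_of_rowLen_eq fun i => ?_
  by_cases hi : i < a ∨ b < i
  · rw [← h.eq_off i hi, ← h'.eq_off i hi]
  · rcases (show i ≤ b by omega).lt_or_eq with hib | rfl
    · have h1 := h.succ i (by omega) hib
      have h2 := h'.succ i (by omega) hib
      omega
    · have h1 := h.top
      have h2 := h'.top
      omega

/-- A rim hook of size `r` with last row `b` can be added inside the rectangle if the entry
`beads k lam b + r` is less than `m + k` and not yet taken. -/
theorem exists_hookRows_outer {k m b r : ℕ} {lam : YoungDiagram} (hlam : lam ≤ rect k m)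
    (hr : 0 < r) (hb : b < k) (hbm : lam.rowLen b + r ≤ m + b)
    (hne : ∀ i < k, lam.rowLen i + b ≠ lam.rowLen b + r + i) :
    ∃ μ ≤ rect k m, ∃ a, HookRows μ lam a b r := by
  classical
  obtain ⟨h0, hk⟩ := le_rect_iff.mp hlam
  have hex : ∃ i, lam.rowLen i + b < lam.rowLen b + r + i := ⟨b, by omega⟩
  have ha := Nat.find_spec hex
  have hab : Nat.find hex ≤ b := Nat.find_min' hex (by omega)
  have hmin : ∀ i < Nat.find hex, lam.rowLen b + r + i < lam.rowLen i + b := by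
    intro i hi
    have h1 := Nat.find_min hex hi
    have h2 := hne i (by omega)
    omega
  generalize Nat.find hex = a at ha hab hmin
  have hanti := fun i => lam.rowLen_anti i (i + 1) (Nat.le_succ i)
  obtain ⟨μ, hμ⟩ := exists_rowLen_eq (k := k) (f := fun i =>
    if i < a ∨ b < i then lam.rowLen i else if i = a then lam.rowLen b + r + a - b
      else lam.rowLen (i - 1) + 1) (antitone_nat_of_succ_le fun i => by
        have h1 := hanti i
        have h2 := hanti (i - 1)
        have h3 := hmin i
        rcases Nat.eq_zero_or_pos i with rfl | hi
        · simp only [zero_add, Nat.sub_self] at h1 h3 ⊢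
          split_ifs <;> (try subst a) <;> omega
        · rw [show i - 1 + 1 = i by omega] at h2
          simp only [Nat.add_sub_cancel]
          split_ifs <;> (try subst a) <;> grind)
    (by simp [hb, hk])
  refine ⟨μ, le_rect_iff.mpr ⟨?_, ?_⟩, a, hab, ?_, ?_, ?_⟩
  · rw [hμ]
    split_ifs <;> grind
  · rw [hμ, if_pos (Or.inr hb), hk]
  · intro i hi
    rw [hμ, if_pos hi]
  · intro i h1 h2
    rw [hμ, if_neg (by omega), if_neg (by omega), Nat.add_sub_cancel]
  · rw [hμ, if_neg (by omega), if_pos rfl]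
    omega

/-- A rim hook of size `s` with first row `a` can be removed if the entry `beads k lam a - s` is
nonnegative and not yet taken. -/
theorem exists_hookRows_inner {k a s : ℕ} {lam : YoungDiagram} (hlam : lam.rowLen k = 0)
    (hs : 0 < s) (ha : a < k) (has : a + s < lam.rowLen a + k)
    (hne : ∀ i < k, lam.rowLen i + a + s ≠ lam.rowLen a + i) :
    ∃ ν, ∃ b < k, HookRows lam ν a b s := by
  classical
  have hex : ∃ i, a ≤ i ∧ (i + 1 = k ∨ lam.rowLen (i + 1) + a + s < lam.rowLen a + (i + 1)) :=
    ⟨k - 1, by omega, by omega⟩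
  obtain ⟨hab, hb⟩ := Nat.find_spec hex
  have hbk : Nat.find hex ≤ k - 1 := Nat.find_min' hex ⟨by omega, by omega⟩
  have hmin : ∀ i, a ≤ i → i < Nat.find hex →
      lam.rowLen a + (i + 1) < lam.rowLen (i + 1) + a + s := by
    intro i hai hi
    have h1 := Nat.find_min hex hi
    have h2 := hne (i + 1) (by omega)
    omega
  generalize Nat.find hex = b at hab hb hbk hmin
  have hb1 : lam.rowLen (b + 1) + a + s < lam.rowLen a + (b + 1) := by
    rcases hb with rfl | hb <;> omega
  have hpos : ∀ i, a ≤ i → i < b → 0 < lam.rowLen (i + 1) := by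
    intro i hai hib
    have h1 := hmin (b - 1) (by omega) (by omega)
    rw [show b - 1 + 1 = b by omega] at h1
    have h2 := lam.rowLen_anti (i + 1) b (by omega)
    omega
  have hanti := fun i => lam.rowLen_anti i (i + 1) (Nat.le_succ i)
  obtain ⟨ν, hν⟩ := exists_rowLen_eq (k := k) (f := fun i =>
    if i < a ∨ b < i then lam.rowLen i else if i = b then lam.rowLen a + b - (a + s)
      else lam.rowLen (i + 1) - 1) (antitone_nat_of_succ_le fun i => by
        have h1 := hanti i
        have h2 := hanti (i + 1)
        have h3 := hmin i
        split_ifs <;> grind)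
    (by simp [show b < k by omega, hlam])
  refine ⟨ν, b, by omega, hab, ?_, ?_, ?_⟩
  · intro i hi
    rw [hν, if_pos hi]
  · intro i h1 h2
    have := hpos i h1 h2
    rw [hν, if_neg (by omega), if_neg (by omega)]
    omega
  · rw [hν, if_neg (by omega), if_pos rfl]
    omega

/-! ### Rim hooks and alternants -/

theorem cycleIcc_val {k : ℕ} {a b : Fin k} (hab : a ≤ b) (i : Fin k) :
    (Fin.cycleIcc a b i : ℕ) =
      if i < a ∨ b < i then (i : ℕ) else if i = b then (a : ℕ) else i + 1 := by
  have : NeZero k := ⟨by have := i.2; omega⟩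
  split_ifs with h1 h2
  · rcases h1 with h | h
    · rw [Fin.cycleIcc_of_lt h]
    · rw [Fin.cycleIcc_of_gt h]
  · rw [h2, Fin.cycleIcc_of_last hab]
  · push Not at h1
    have hlt : i < b := lt_of_le_of_ne h1.2 h2
    rw [Fin.cycleIcc_of_ge_of_lt h1.1 hlt, Fin.val_add_one_of_lt' (by
      have := b.2
      have : (i : ℕ) < b := hlt
      omega)]

theorem HookRows.beads_comp_cycleIcc {k r : ℕ} {μ lam : YoungDiagram} {a b : Fin k}
    (h : HookRows μ lam a b r) :
    beads k μ ∘ Fin.cycleIcc a b =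
      Function.update (beads k lam) b (beads k lam b + r) := by
  have hab : a ≤ b := h.le
  funext i
  have hi := i.2
  have hb := b.2
  have htop := h.top
  simp only [Function.comp_apply, Function.update_apply, beads, cycleIcc_val hab, Fin.lt_def,
    Fin.ext_iff]
  by_cases h1 : (i : ℕ) < a ∨ (b : ℕ) < i
  · rw [if_pos h1, if_neg (by omega), h.eq_off i h1]
  · by_cases h2 : (i : ℕ) = b
    · rw [if_neg h1, if_pos h2, if_pos h2]
      omega
    · have h3 := h.succ i (by omega) (by omega)
      rw [if_neg h1, if_neg h2, if_neg h2, h3]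
      omega

variable {R : Type*} [CommRing R] {k : ℕ} {u : ℕ → R}

/-- Sorting the exponents after the `b`-th one has been increased by `r` gives the sign of the rim
hook. -/
theorem HookRows.alternant_update_outer {r : ℕ} {μ lam : YoungDiagram} {a b : Fin k}
    (h : HookRows μ lam a b r) (hr : 0 < r) :
    alternant u (Function.update (beads k lam) b (beads k lam b + r)) =
      (-1) ^ (height μ lam + 1) * alternant u (beads k μ) := by
  rw [← h.beads_comp_cycleIcc, alternant_comp_perm, Fin.sign_cycleIcc_of_le h.le, h.height_eq hr,
    pow_add, pow_add]
  simp

theorem HookRows.alternant_update_inner {s : ℕ} {lam ν : YoungDiagram} {a b : Fin k}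
    (h : HookRows lam ν a b s) (hs : 0 < s) :
    alternant u (Function.update (beads k lam) a (beads k lam a - s)) =
      (-1) ^ (height lam ν + 1) * alternant u (beads k ν) := by
  have hab : a ≤ b := h.le
  have hbeads := h.beads_comp_cycleIcc
  have hlast : Fin.cycleIcc a b b = a := Fin.ext (by simp [cycleIcc_val hab, hab.not_gt])
  have ha : beads k lam a = beads k ν b + s := by
    simpa [hlast] using congrFun hbeads b
  have hcomp : Function.update (beads k lam) a (beads k lam a - s) ∘ Fin.cycleIcc a b =
      beads k ν := by
    funext i
    by_cases hi : i = b
    · rw [hi, Function.comp_apply, hlast, Function.update_self, ha, Nat.add_sub_cancel]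
    · have hne : Fin.cycleIcc a b i ≠ a := fun h =>
        hi ((Fin.cycleIcc a b).injective (h.trans hlast.symm))
      rw [Function.comp_apply, Function.update_of_ne hne]
      have := congrFun hbeads i
      rwa [Function.update_of_ne hi] at this
  have hsign : ((-1) ^ (height lam ν + 1) : R) * (-1) ^ ((b : ℕ) - a) = 1 := by
    rw [h.height_eq hs, ← pow_add, show (b : ℕ) - a + 1 + 1 + (b - a) = 2 * (b - a + 1) by omega,
      pow_mul]
    simp
  rw [← hcomp, alternant_comp_perm, Fin.sign_cycleIcc_of_le hab, ← mul_assoc]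
  push_cast
  rw [hsign, one_mul]

theorem alternant_update_eq_zero {γ : Fin k → ℕ} {i j : Fin k} {m : ℕ} (hij : i ≠ j)
    (h : γ i = m) : alternant u (Function.update γ j m) = 0 :=
  alternant_eq_zero u hij (by rw [Function.update_of_ne hij, Function.update_self, h])

open Classical in
/-- Adding rim hooks of size `r` within the rectangle is increasing an exponent by `r` without
exceeding `n - 1`; the other terms vanish, as they have a repeated exponent. -/
theorem sum_alternant_outer {n r : ℕ} (hk : 0 < k) (hr : 0 < r) (hkn : k < n)
    {lam : YoungDiagram} (hlam : lam ≤ rect k (n - k)) :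
    ∑ b : Fin k with beads k lam b + r < n,
        alternant u (Function.update (beads k lam) b (beads k lam b + r)) =
      ∑ μ ∈ below (rect k (n - k)) with IsRimHook μ lam ∧ skewSize μ lam = r,
        (-1) ^ (height μ lam + 1) * alternant u (beads k μ) := by
  have hrow : ∀ μ ∈ (below (rect k (n - k))).filter
      (fun μ => IsRimHook μ lam ∧ skewSize μ lam = r),
      ∃ a b : Fin k, HookRows μ lam a b r := by
    intro μ hμ
    rw [Finset.mem_filter, mem_below, isRimHook_and_skewSize_eq_iff hr] at hμ
    obtain ⟨hle, a, b, h⟩ := hμ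
    have hb : b < k := by
      by_contra! hkb
      have h1 := h.rowLen_lt hr h.le le_rfl
      have h2 := μ.rowLen_anti k b hkb
      have h3 := (le_rect_iff.mp hle).2
      omega
    exact ⟨⟨a, h.le.trans_lt hb⟩, ⟨b, hb⟩, h⟩
  have : Nonempty (Fin k) := ⟨⟨0, hk⟩⟩
  have hex : ∀ μ, ∃ b : Fin k, μ ∈ (below (rect k (n - k))).filter
      (fun μ => IsRimHook μ lam ∧ skewSize μ lam = r) → ∃ a : Fin k, HookRows μ lam a b r := by
    intro μ
    by_cases hμ : μ ∈ (below (rect k (n - k))).filter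
      (fun μ => IsRimHook μ lam ∧ skewSize μ lam = r)
    · obtain ⟨a, b, h⟩ := hrow μ hμ
      exact ⟨b, fun _ => ⟨a, h⟩⟩
    · exact ⟨Classical.arbitrary _, fun h => absurd h hμ⟩
  choose e he using hex
  symm
  refine Finset.sum_of_injOn e ?_ ?_ ?_ ?_
  · intro μ hμ μ' hμ' hee
    obtain ⟨a, h⟩ := he μ hμ
    obtain ⟨a', h'⟩ := he μ' hμ'
    rw [← hee] at h'
    exact h.outer_unique h'
  · intro μ hμ
    obtain ⟨a, h⟩ := he μ hμ
    have hle := le_rect_iff.mp (mem_below.mp (Finset.mem_filter.mp hμ).1)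
    have h1 := μ.rowLen_anti 0 a (Nat.zero_le _)
    have h2 := h.top
    have h3 := (e μ).2
    have h4 := a.2
    refine Finset.mem_coe.mpr (Finset.mem_filter.mpr ⟨Finset.mem_univ _, ?_⟩)
    rw [beads]
    omega
  · intro b hb hnot
    by_contra hne0
    rw [Finset.mem_filter, beads] at hb
    have hbk := b.2
    have hne : ∀ i < k, lam.rowLen i + b ≠ lam.rowLen b + r + i := by
      intro i hi heq
      refine hne0 (alternant_update_eq_zero (i := ⟨i, hi⟩) ?_ ?_)
      · rintro rfl
        simp only at heq
        omega
      · simp only [beads]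
        omega
    obtain ⟨μ, hμ, a, h⟩ := exists_hookRows_outer hlam hr b.2 (by omega) hne
    have hmem : μ ∈ (below (rect k (n - k))).filter
        (fun μ => IsRimHook μ lam ∧ skewSize μ lam = r) :=
      Finset.mem_filter.mpr ⟨mem_below.mpr hμ, (isRimHook_and_skewSize_eq_iff hr).mpr ⟨a, b, h⟩⟩
    obtain ⟨a', h'⟩ := he μ hmem
    exact hnot ⟨μ, hmem, Fin.ext (h'.rows_unique h hr).2⟩
  · intro μ hμ
    obtain ⟨a, h⟩ := he μ hμ
    exact (h.alternant_update_outer hr).symm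

open Classical in
/-- Removing rim hooks of size `s` is decreasing an exponent by `s`; the other terms vanish, as
they have a repeated exponent. -/
theorem sum_alternant_inner {s : ℕ} (hk : 0 < k) (hs : 0 < s) {lam : YoungDiagram}
    (hlam : lam.rowLen k = 0) :
    ∑ a : Fin k with s ≤ beads k lam a,
        alternant u (Function.update (beads k lam) a (beads k lam a - s)) =
      ∑ ν ∈ below lam with IsRimHook lam ν ∧ skewSize lam ν = s,
        (-1) ^ (height lam ν + 1) * alternant u (beads k ν) := by
  have : Nonempty (Fin k) := ⟨⟨0, hk⟩⟩
  have hex : ∀ ν, ∃ a : Fin k, ν ∈ (below lam).filter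
      (fun ν => IsRimHook lam ν ∧ skewSize lam ν = s) → ∃ b : Fin k, HookRows lam ν a b s := by
    intro ν
    by_cases hν : ν ∈ (below lam).filter (fun ν => IsRimHook lam ν ∧ skewSize lam ν = s)
    · obtain ⟨a, b, h⟩ :=
        (isRimHook_and_skewSize_eq_iff hs).mp (Finset.mem_filter.mp hν).2
      have hb : b < k := by
        by_contra! hkb
        have h1 := h.rowLen_lt hs h.le le_rfl
        have h2 := lam.rowLen_anti k b hkb
        omega
      exact ⟨⟨a, h.le.trans_lt hb⟩, fun _ => ⟨⟨b, hb⟩, h⟩⟩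
    · exact ⟨Classical.arbitrary _, fun h => absurd h hν⟩
  choose e he using hex
  symm
  refine Finset.sum_of_injOn e ?_ ?_ ?_ ?_
  · intro ν hν ν' hν' hee
    obtain ⟨b, h⟩ := he ν hν
    obtain ⟨b', h'⟩ := he ν' hν'
    rw [← hee] at h'
    exact h.inner_unique h'
  · intro ν hν
    obtain ⟨b, h⟩ := he ν hν
    have h2 := h.top
    have h3 := (e ν).2
    have h4 := b.2
    refine Finset.mem_coe.mpr (Finset.mem_filter.mpr ⟨Finset.mem_univ _, ?_⟩)
    rw [beads]
    omega
  · intro a ha hnot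
    by_contra hne0
    rw [Finset.mem_filter, beads] at ha
    have hak := a.2
    have hne : ∀ i < k, lam.rowLen i + a + s ≠ lam.rowLen a + i := by
      intro i hi heq
      refine hne0 (alternant_update_eq_zero (i := ⟨i, hi⟩) ?_ ?_)
      · rintro rfl
        simp only at heq
        omega
      · simp only [beads]
        omega
    obtain ⟨ν, b, hb, h⟩ := exists_hookRows_inner hlam hs a.2 (by omega) hne
    have hmem : ν ∈ (below lam).filter (fun ν => IsRimHook lam ν ∧ skewSize lam ν = s) :=
      Finset.mem_filter.mpr ⟨mem_below.mpr (h.lam_le hs),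
        (isRimHook_and_skewSize_eq_iff hs).mpr ⟨a, b, h⟩⟩
    obtain ⟨b', h'⟩ := he ν hmem
    exact hnot ⟨ν, hmem, Fin.ext (h'.rows_unique h hs).1⟩
  · intro ν hν
    obtain ⟨b, h⟩ := he ν hν
    exact (h.alternant_update_inner hs).symm

open Classical in
/-- The rim hook rule for any sequence `u` which satisfies a linear recurrence of order `k` and
is quasi-periodic with period `n`. -/
theorem trace_mul_alternant_beads {n r : ℕ} {c : Fin k → R} {ε : R}
    (hu : ∀ m, u (m + k) = ∑ j : Fin k, u (m + j) * c j) (hε : ∀ m, u (m + n) = ε * u m)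
    (hk : 0 < k) (hr : 0 < r) (hkn : k < n) (hrn : r < n)
    {lam : YoungDiagram} (hlam : lam ≤ rect k (n - k)) :
    (companion c ^ r).trace * alternant u (beads k lam) =
      (∑ μ ∈ below (rect k (n - k)) with IsRimHook μ lam ∧ skewSize μ lam = r,
        (-1) ^ (height μ lam + 1) * alternant u (beads k μ)) +
      ε * ∑ ν ∈ below lam with IsRimHook lam ν ∧ skewSize lam ν = n - r,
        (-1) ^ (height lam ν + 1) * alternant u (beads k ν) := by
  rw [trace_mul_alternant hu, ← sum_alternant_outer hk hr hkn hlam,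
    ← sum_alternant_inner hk (Nat.sub_pos_of_lt hrn) (le_rect_iff.mp hlam).2, Finset.mul_sum,
    ← Finset.sum_filter_add_sum_filter_not _ (fun b => beads k lam b + r < n)]
  congr 1
  refine Finset.sum_congr (Finset.filter_congr fun b _ => by omega) fun b hb => ?_
  rw [Finset.mem_filter] at hb
  rw [← alternant_update_add hε]
  congr 2
  omega

/-! ### The quantum product with a power sum -/

theorem sigma_eq_alternant (k n : ℕ) (lam : YoungDiagram) :
    sigma k n lam = alternant (fun m => clsHom k n (shiftedComplete k m)) (beads k lam) := by
  rw [sigma, ← alternant_beads]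
  exact map_alternant (R := SymPoly k) (S := QH k n) (clsHom k n) _ _

theorem cls_powerSum (k n r : ℕ) :
    cls k n (powerSum k r) =
      (companion (fun j => clsHom k n (recurrenceCoeff k j)) ^ r).trace := by
  rw [← trace_companion_recurrenceCoeff_pow]
  exact trace_map_companion_pow (R := SymPoly k) (S := QH k n) (clsHom k n) _ _

end QuantumGr

open Classical in
theorem theorem2 (k r n : ℕ) (hk : 0 < k) (hr : 0 < r) (hkn : k < n) (hrn : r < n)
    (lam : YoungDiagram) (hlam : lam ≤ QuantumGr.rect k (n - k)) :
    QuantumGr.cls k n (QuantumGr.powerSum k r) * QuantumGr.sigma k n lam =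
      (∑ μ ∈ QuantumGr.below (QuantumGr.rect k (n - k)) with
          QuantumGr.IsRimHook μ lam ∧ QuantumGr.skewSize μ lam = r,
        (-1) ^ (QuantumGr.height μ lam + 1) * QuantumGr.sigma k n μ)
      - (-1) ^ k * QuantumGr.q k n *
        (∑ ν ∈ QuantumGr.below lam with
          QuantumGr.IsRimHook lam ν ∧ QuantumGr.skewSize lam ν = n - r,
        (-1) ^ (QuantumGr.height lam ν + 1) * QuantumGr.sigma k n ν) := by
  have h := QuantumGr.trace_mul_alternant_beads (R := QuantumGr.QH k n)
    (u := fun m => QuantumGr.clsHom k n (QuantumGr.shiftedComplete k m))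
    (ε := -(-1) ^ k * QuantumGr.q k n)
    (QuantumGr.clsHom_shiftedComplete_recurrence k n)
    (QuantumGr.clsHom_shiftedComplete_add hkn) hk hr hkn hrn hlam
  -- stated for an abstract ring: `QH k n` carries several ring structures which agree only after
  -- unfolding, and this stops `ring`
  have key : ∀ {R : Type} [CommRing R] {a b c d e : R}, a = b + -c * d * e → a = b - c * d * e :=
    fun h => by linear_combination h
  simp only [QuantumGr.sigma_eq_alternant, QuantumGr.cls_powerSum]
  exact key (R := QuantumGr.QH k n) h
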